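/- Let $\Omega\subset\mathbb C^n$ be a bounded strongly pseudoconvex domain with $C^2$ boundary; that is, $\Omega$ is a bounded connected open set and every $p\in\partial\Omega$ has an open neighbourhood $U$ with a $C^2$ function $\rho:U\to\mathbb R$ such that $\Omega\cap U=\{w\in U:\rho(w)<0\}$, $d\rho(p)\neq 0$, and $\sum_{j,k}\frac{\partial^2\rho}{\partial z_j\partial\bar z_k}(p)\,v_j\bar v_k>0$ for every $v\in\mathbb C^n\setminus\{0\}$ with $\sum_j\frac{\partial\rho}{\partial z_j}(p)\,v_j=0$. Let $d^K_\Omega$ be the Kobayashi distance of $\Omega$: $d^K_\Omega(x,y)$ is the infimum of $\sum_{i=1}^m d_\Delta(a_i,b_i)$ over all finite chains of holomorphic maps $f_i:\Delta\to\Omega$ from the unit disc $\Delta\subset\mathbb C$ and points $a_i,b_i\in\Delta$ with $f_1(a_1)=x$, $f_i(b_i)=f_{i+1}(a_{i+1})$ for $1\le i<m$, and $f_m(b_m)=y$, where $d_\Delta(a,b)=\log\frac{1+t}{1-t}$, $t=\left|\frac{a-b}{1-\bar b a}\right|$, is the Poincaré distance. Let $\delta(w)=\operatorname{dist}(w,\partial\Omega)$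 be the Euclidean distance to the boundary. Let $\{x_k\}$, $\{y_k\}$ be sequences in $\Omega$ with $\lim_{k\to\infty}x_k=\lim_{k\to\infty}y_k=z\in\partial\Omega$ and $\lim_{k\to\infty}d^K_\Omega(x_k,y_k)=0$. Then $$\lim_{k\to\infty}\frac{\delta(x_k)}{\delta(y_k)}=1.$$ -/

import Mathlib

open Filter Topology Metric

noncomputable section

/-- The Levi form of `ρ` at `p` in the direction `v`, that is
`∑ j k, (∂²ρ / ∂z_j ∂z̄_k)(p) v_j v̄_k`. In terms of the real second derivative of `ρ` this sum is
`(D²ρ(p)(v, v) + D²ρ(p)(iv, iv)) / 4`, a quarter of the Laplacian at `0` of the function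
`ζ ↦ ρ (p + ζ v)` of one complex variable. -/
def leviForm {n : ℕ} (ρ : EuclideanSpace ℂ (Fin n) → ℝ) (p v : EuclideanSpace ℂ (Fin n)) : ℝ :=
  (fderiv ℝ (fderiv ℝ ρ) p v v
    + fderiv ℝ (fderiv ℝ ρ) p (Complex.I • v) (Complex.I • v)) / 4

/-- `Ω` is a (bounded) strongly pseudoconvex domain in `ℂⁿ` with boundary of class `C²`: near every
boundary point `p` it is given as `{ρ < 0}` by a `C²` function `ρ` with `dρ(p) ≠ 0`, whose Levi form
at `p` is positive definite on the complex tangent space of the boundary at `p`, which is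
`{v | dρ(p) v = 0 and dρ(p) (iv) = 0}`. -/
structure IsStronglyPseudoconvexDomain {n : ℕ} (Ω : Set (EuclideanSpace ℂ (Fin n))) : Prop where
  isOpen : IsOpen Ω
  isConnected : IsConnected Ω
  isBounded : Bornology.IsBounded Ω
  exists_definingFunction : ∀ p ∈ frontier Ω,
    ∃ (U : Set (EuclideanSpace ℂ (Fin n))) (ρ : EuclideanSpace ℂ (Fin n) → ℝ),
      IsOpen U ∧ p ∈ U ∧ ContDiffOn ℝ 2 ρ U ∧ Ω ∩ U = {w ∈ U | ρ w < 0} ∧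
      fderiv ℝ ρ p ≠ 0 ∧
      ∀ v : EuclideanSpace ℂ (Fin n), v ≠ 0 → fderiv ℝ ρ p v = 0 →
        fderiv ℝ ρ p (Complex.I • v) = 0 → 0 < leviForm ρ p v

/-- The Poincaré distance on the unit disc, `log ((1 + t) / (1 - t))` with
`t = |(a - b) / (1 - b̄ a)|`. -/
def poincareDist (a b : ℂ) : ℝ :=
  Real.log ((1 + ‖(a - b) / (1 - (starRingEnd ℂ) b * a)‖) /
    (1 - ‖(a - b) / (1 - (starRingEnd ℂ) b * a)‖))

/-- `L` is the length of a chain of holomorphic discs in `Ω` from `x` to `y`: there are points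
`x = p 0, p 1, …, p m = y`, holomorphic maps `f i` from the unit disc to `Ω` and points `a i`, `b i`
of the unit disc with `f i (a i) = p i` and `f i (b i) = p (i + 1)`, and `L` is the sum of the
Poincaré distances of `a i` and `b i`. -/
def IsDiscChainLength {n : ℕ} (Ω : Set (EuclideanSpace ℂ (Fin n)))
    (x y : EuclideanSpace ℂ (Fin n)) (L : ℝ) : Prop :=
  ∃ (m : ℕ) (p : ℕ → EuclideanSpace ℂ (Fin n)) (f : ℕ → ℂ → EuclideanSpace ℂ (Fin n))
    (a b : ℕ → ℂ),
    p 0 = x ∧ p m = y ∧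
    (∀ i < m, DifferentiableOn ℂ (f i) (ball 0 1) ∧ Set.MapsTo (f i) (ball 0 1) Ω ∧
      a i ∈ ball (0 : ℂ) 1 ∧ b i ∈ ball (0 : ℂ) 1 ∧ f i (a i) = p i ∧ f i (b i) = p (i + 1)) ∧
    L = ∑ i ∈ Finset.range m, poincareDist (a i) (b i)

/-- The Kobayashi distance of `Ω`: the infimum of the lengths of all chains of holomorphic discs
in `Ω` from `x` to `y`. (It would be `∞` if there were no chain; in a domain there always is one.) -/
def kobayashiDist {n : ℕ} (Ω : Set (EuclideanSpace ℂ (Fin n)))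
    (x y : EuclideanSpace ℂ (Fin n)) : ENNReal :=
  ⨅ (L : ℝ) (_ : IsDiscChainLength Ω x y L), ENNReal.ofReal L

end

/-! Near `z`, `Ω` is `{g < 0}` with `g` of class `C²` and Levi form at least `c‖v‖²` at `z`. The
heart of the proof is that `log (-g)` is Lipschitz along short chains of discs starting near `z`.
For a disc `f` near `z`, put `V = f - f 0` and `d = -g (f 0)`. Taylor's formula at `f 0` reads `g ∘
f = -d + Re h + Levi(V) + error`, where `h` is holomorphic, `h 0 = 0`, and the error is at most `c/2
‖V‖²`. Since `g ∘ f < 0`, `Re h + c/2 ‖V‖² ≤ d`. Borel–Carathéodory bounds `h`, and then Schwarz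
bounds `‖V‖²`, by multiples of `d‖ζ‖/R`; so `g` changes by a relative amount `O(‖ζ‖/R)`
(`exists_ball_abs_sub_le_along_disc`). As `Ω` is bounded, Schwarz also keeps short chains near `z`,
and the estimates add up (`exists_abs_log_sub_le_of_isDiscChainLength`). Hence `g (y k) / g (x k) →
1`. Finally `-g / δ → ‖dg(z)‖` inside `Ω` (`tendsto_neg_div_infDist_frontier`), which turns this
into the claim on `δ`. -/

/-- A function with symmetric strict second derivative `B` at `z` satisfies the second order Taylor
formula with quadratic part `B`, uniformly in the base point near `z`. -/
theorem exists_ball_taylor_second_order {E : Type*} [NormedAddCommGroup E] [NormedSpace ℝ E]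
    {g : E → ℝ} {z : E} {B : E →L[ℝ] E →L[ℝ] ℝ} (hg : ∀ᶠ x in 𝓝 z, DifferentiableAt ℝ g x)
    (hB : HasStrictFDerivAt (fderiv ℝ g) B z) (hsymm : ∀ u v, B u v = B v u)
    {ε : ℝ} (hε : 0 < ε) :
    ∃ r > 0, ∀ w ∈ ball z r, ∀ q ∈ ball z r,
      |g q - g w - fderiv ℝ g w (q - w) - B (q - w) (q - w) / 2| ≤ ε * ‖q - w‖ ^ 2 := by
  obtain ⟨r₁, hr₁, h₁⟩ := Metric.eventually_nhds_iff_ball.1 hg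
  obtain ⟨r₂, hr₂, h₂⟩ := Metric.eventually_nhds_iff_ball.1 (hB.isLittleO.def hε)
  refine ⟨min r₁ r₂, lt_min hr₁ hr₂, fun w hw q hq => ?_⟩
  have hseg : segment ℝ w q ⊆ ball z (min r₁ r₂) := (convex_ball z _).segment_subset hw hq
  -- Mean value inequality for the Taylor remainder as a function of `x`: by symmetry of `B` its
  -- derivative is exactly the quantity controlled by strict differentiability.
  have hder : ∀ x ∈ segment ℝ w q, HasFDerivWithinAt
      (fun x => g x - g w - fderiv ℝ g w (x - w) - B (x - w) (x - w) / 2)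
      (fderiv ℝ g x - fderiv ℝ g w - B (x - w)) (segment ℝ w q) x := by
    intro x hx
    have hgx : HasFDerivAt g (fderiv ℝ g x) x :=
      (h₁ x (ball_subset_ball (min_le_left _ _) (hseg hx))).hasFDerivAt
    have hs : HasFDerivAt (fun x : E => x - w) (ContinuousLinearMap.id ℝ E) x :=
      (hasFDerivAt_id x).sub_const w
    have hBx : HasFDerivAt (fun x => B (x - w)) (B.comp (ContinuousLinearMap.id ℝ E)) x :=
      B.hasFDerivAt.comp x hs
    have := ((hgx.sub_const (g w)).sub
      ((fderiv ℝ g w).hasFDerivAt.comp x hs)).sub ((hBx.clm_apply hs).mul_const (1 / 2 : ℝ))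
    refine HasFDerivAt.hasFDerivWithinAt ?_
    refine (this.congr_fderiv ?_).congr_of_eventuallyEq (Eventually.of_forall fun y => ?_)
    · ext v
      simp only [map_sub, sub_apply, hsymm v, ContinuousLinearMap.comp_id,
        smul_apply, add_apply,
        ContinuousLinearMap.flip_apply, smul_eq_mul]
      ring
    · simp [div_eq_mul_inv]
  have hbd : ∀ x ∈ segment ℝ w q, ‖fderiv ℝ g x - fderiv ℝ g w - B (x - w)‖ ≤ ε * ‖q - w‖ := by
    intro x hx
    have hxw : ‖x - w‖ ≤ ‖q - w‖ := by
      obtain ⟨t, ht, rfl⟩ := (segment_eq_image' ℝ w q ▸ hx : x ∈ _)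
      simp only [add_sub_cancel_left, norm_smul, Real.norm_eq_abs, abs_of_nonneg ht.1]
      exact mul_le_of_le_one_left (norm_nonneg _) ht.2
    refine (h₂ (x, w) ?_).trans (by gcongr)
    rw [← ball_prod_same]
    exact ⟨ball_subset_ball (min_le_right _ _) (hseg hx), ball_subset_ball (min_le_right _ _) hw⟩
  have := (convex_segment w q).norm_image_sub_le_of_norm_hasFDerivWithin_le hder hbd
    (left_mem_segment ℝ w q) (right_mem_segment ℝ w q)
  simp only [sub_self, map_zero, zero_div, sub_zero, Real.norm_eq_abs] at this
  linarith

/-- On a finite-dimensional space, a quadratic quantity `F` that is positive on the zero set of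
`G ≥ 0` dominates the square of the norm after adding a multiple of `G`. -/
theorem exists_add_mul_ge_norm_sq {E : Type*} [NormedAddCommGroup E] [NormedSpace ℝ E]
    [FiniteDimensional ℝ E] {F G : E → ℝ} (hF : Continuous F) (hG : Continuous G)
    (hF2 : ∀ (t : ℝ) v, F (t • v) = t ^ 2 * F v) (hG2 : ∀ (t : ℝ) v, G (t • v) = t ^ 2 * G v)
    (hG0 : ∀ v, 0 ≤ G v) (hpos : ∀ v, v ≠ 0 → G v = 0 → 0 < F v) :
    ∃ M > 0, ∃ c > 0, ∀ v, c * ‖v‖ ^ 2 ≤ F v + M * G v := by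
  -- Compactness of the unit sphere: these open sets increase with `k` because `G ≥ 0`, so one of
  -- them covers it.
  obtain ⟨N, hN⟩ := (isCompact_sphere (0 : E) 1).elim_directed_cover
    (fun k : ℕ => {v | 1 / ((k : ℝ) + 1) < F v + ((k : ℝ) + 1) * G v})
    (fun k => isOpen_lt continuous_const (by fun_prop))
    (fun v hv => by
      have hv0 : v ≠ 0 := by
        rintro rfl
        simp at hv
      rw [Set.mem_iUnion]
      have h0 : Tendsto (fun k : ℕ => 1 / ((k : ℝ) + 1)) atTop (𝓝 0) :=
        tendsto_one_div_add_atTop_nhds_zero_nat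
      rcases (hG0 v).eq_or_lt with h | h
      · have := hpos v hv0 h.symm
        obtain ⟨k, hk⟩ := (h0.eventually (gt_mem_nhds this)).exists
        exact ⟨k, by simpa [← h] using hk⟩
      · obtain ⟨k, hk⟩ := exists_nat_gt ((1 - F v) / G v)
        refine ⟨k, ?_⟩
        rw [div_lt_iff₀ h] at hk
        have : 1 / ((k : ℝ) + 1) ≤ 1 := by
          rw [div_le_one (by positivity)]
          linarith [Nat.cast_nonneg (α := ℝ) k]
        change 1 / ((k : ℝ) + 1) < _
        linarith)
    (by
      refine Monotone.directed_le fun k l hkl v hv => ?_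
      have hkl' : (k : ℝ) ≤ l := by exact_mod_cast hkl
      have h1 : 1 / ((l : ℝ) + 1) ≤ 1 / ((k : ℝ) + 1) := by gcongr
      have h2 : ((k : ℝ) + 1) * G v ≤ ((l : ℝ) + 1) * G v := by
        gcongr
        exact hG0 v
      have h3 : 1 / ((k : ℝ) + 1) < F v + ((k : ℝ) + 1) * G v := hv
      change 1 / ((l : ℝ) + 1) < F v + ((l : ℝ) + 1) * G v
      linarith)
  refine ⟨N + 1, by positivity, 1 / (N + 1), by positivity, fun v => ?_⟩
  have hv' : v = ‖v‖ • (‖v‖⁻¹ • v) := by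
    rcases eq_or_ne v 0 with rfl | h
    · simp
    · rw [smul_smul, mul_inv_cancel₀ (norm_ne_zero_iff.2 h), one_smul]
  rcases eq_or_ne v 0 with rfl | h
  · have h1 := hF2 0 0
    have h2 := hG2 0 0
    simp at h1 h2
    simp [h1, h2]
  · have hmem : ‖v‖⁻¹ • v ∈ sphere (0 : E) 1 := by simp [norm_smul, h]
    have h1 : 1 / ((N : ℝ) + 1) < F (‖v‖⁻¹ • v) + ((N : ℝ) + 1) * G (‖v‖⁻¹ • v) := hN hmem
    have h2 : F v = ‖v‖ ^ 2 * F (‖v‖⁻¹ • v) := by rw [← hF2, ← hv']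
    have h3 : G v = ‖v‖ ^ 2 * G (‖v‖⁻¹ • v) := by rw [← hG2, ← hv']
    rw [h2, h3]
    nlinarith [mul_le_mul_of_nonneg_left h1.le (sq_nonneg ‖v‖)]

/-! ### Estimates along holomorphic discs -/

/-- If `h` and `V` are holomorphic on a disc, vanish at the centre and satisfy
`Re h + c ‖V‖² ≤ d`, then `h` and `‖V‖²` are bounded by multiples of `d`. -/
theorem norm_le_of_re_add_mul_norm_sq_le {E : Type*} [NormedAddCommGroup E] [NormedSpace ℂ E]
    {h : ℂ → ℂ} {V : ℂ → E} {c d R : ℝ} (hc : 0 < c) (hd : 0 < d) (hR : 0 < R)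
    (hh : DifferentiableOn ℂ h (ball 0 R)) (hV : DifferentiableOn ℂ V (ball 0 R))
    (hh0 : h 0 = 0) (hV0 : V 0 = 0)
    (hle : ∀ ζ ∈ ball (0 : ℂ) R, (h ζ).re + c * ‖V ζ‖ ^ 2 ≤ d) {ζ : ℂ} (hζ : ‖ζ‖ < R / 2) :
    ‖h ζ‖ ≤ 4 * d * (‖ζ‖ / R) ∧ ‖V ζ‖ ^ 2 ≤ 6 * (d / c) * (‖ζ‖ / R) := by
  have key : ∀ ξ : ℂ, ‖ξ‖ < R / 2 → ‖h ξ‖ ≤ 4 * d * (‖ξ‖ / R) := by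
    intro ξ hξ
    have := Complex.borelCaratheodory_zero hd hh
      (fun ξ hξ => by
        have := hle ξ hξ
        have h2 : 0 ≤ c * ‖V ξ‖ ^ 2 := by positivity
        change (h ξ).re ≤ d
        linarith) hR
      (show ξ ∈ ball 0 R by simp; linarith) hh0
    refine this.trans ?_
    rw [show 4 * d * (‖ξ‖ / R) = 2 * d * ‖ξ‖ / (R / 2) by field_simp; ring]
    gcongr
    linarith
  refine ⟨key ζ hζ, ?_⟩
  -- On the half disc `‖h‖ ≤ 2d`, hence `c‖V‖² ≤ d - Re h ≤ 3d`.
  have hV1 : ∀ ξ : ℂ, ‖ξ‖ < R / 2 → ‖V ξ‖ ≤ √(3 * (d / c)) := by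
    intro ξ hξ
    apply Real.le_sqrt_of_sq_le
    have h1 := hle ξ (by simp; linarith)
    have h2 := key ξ hξ
    have h3 : ‖ξ‖ / R ≤ 1 / 2 := by rw [div_le_iff₀ hR]; linarith
    have h4 := Complex.abs_re_le_norm (h ξ)
    have h5 := (abs_le.1 h4).1
    rw [← mul_div_assoc, le_div_iff₀ hc]
    nlinarith
  have h6 := Complex.dist_le_div_mul_dist_of_mapsTo_ball (f := V) (c := 0) (R₁ := R / 2)
    (R₂ := √(3 * (d / c))) (z := ζ) (hV.mono (ball_subset_ball (by linarith)))
    (fun ξ hξ => by simpa [hV0] using hV1 ξ (by simpa using hξ)) (by simpa using hζ)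
  rw [hV0, dist_zero_right, dist_zero_right] at h6
  have h7 : ‖V ζ‖ ^ 2 ≤ (√(3 * (d / c)) / (R / 2) * ‖ζ‖) ^ 2 := by gcongr
  refine h7.trans ?_
  have h8 : (√(3 * (d / c)) / (R / 2) * ‖ζ‖) ^ 2 = 12 * (d / c) * (‖ζ‖ / R) * (‖ζ‖ / R) := by
    rw [mul_pow, div_pow, Real.sq_sqrt (by positivity)]
    field_simp
    ring
  have h3 : ‖ζ‖ / R ≤ 1 / 2 := by rw [div_le_iff₀ hR]; linarith
  have h9 : 0 ≤ 12 * (d / c) * (‖ζ‖ / R) := by positivity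
  rw [h8]
  nlinarith

/-- The part of type `(2, 0)` of a real quadratic form is the real part of a complex one. -/
theorem exists_complex_bilinear_re_eq {E : Type*} [NormedAddCommGroup E] [NormedSpace ℂ E]
    [NormedSpace ℝ E] [IsScalarTower ℝ ℂ E] [FiniteDimensional ℂ E] (B : E →L[ℝ] E →L[ℝ] ℝ) :
    ∃ Q : E →L[ℂ] E →L[ℂ] ℂ,
      ∀ v, (Q v v).re = (B v v - B (Complex.I • v) (Complex.I • v)) / 4 := by
  have hsm : ∀ (c : ℂ) (v : E), c • v = c.re • v + c.im • (Complex.I • v) := by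
    intro c v
    conv_lhs => rw [← Complex.re_add_im c]
    rw [add_smul, mul_smul]
    exact congrArg₂ _ (algebraMap_smul ℂ c.re v) (algebraMap_smul ℂ c.im _)
  have hII : ∀ v : E, Complex.I • Complex.I • v = -v := by
    intro v
    rw [smul_smul, Complex.I_mul_I, neg_one_smul]
  have hIr : ∀ (a : ℝ) (v : E), Complex.I • a • v = a • Complex.I • v := fun a v =>
    smul_comm _ _ _
  -- The real part is the polarized `(2, 0)` part of `B`; the imaginary part is forced by complex
  -- linearity.
  let T : E →ₗ[ℂ] E →ₗ[ℂ] ℂ := LinearMap.mk₂ ℂ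
    (fun u v => ((B u v - B (Complex.I • u) (Complex.I • v) : ℝ) / 4 : ℂ)
      - Complex.I * ((B u (Complex.I • v) + B (Complex.I • u) v : ℝ) / 4 : ℂ))
    (fun u u' v => by
      simp only [map_add, smul_add, add_apply]
      push_cast
      ring)
    (fun c u v => by
      rw [hsm c u]
      apply Complex.ext <;>
      simp [map_add, smul_add, hIr, hII] <;> ring)
    (fun u v v' => by
      simp only [map_add, smul_add]
      push_cast
      ring)
    (fun c u v => by
      rw [hsm c v]
      apply Complex.ext <;>
      simp [map_add, smul_add, hIr, hII] <;> ring)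
  refine ⟨T.toContinuousBilinearMap, fun v => ?_⟩
  simp [T, LinearMap.toContinuousBilinearMap_apply]

/-- Near a point where the Levi form of `g` is positive definite, `g` varies slowly along
holomorphic discs contained in `{g < 0}`. -/
theorem exists_ball_abs_sub_le_along_disc {n : ℕ} {g : EuclideanSpace ℂ (Fin n) → ℝ}
    {z : EuclideanSpace ℂ (Fin n)} (hg : ContDiffAt ℝ 2 g z) {c : ℝ} (hc : 0 < c)
    (hlevi : ∀ v, c * ‖v‖ ^ 2 ≤ leviForm g z v) :
    ∃ r > 0, ∃ C > 0, ∀ R > 0, ∀ f : ℂ → EuclideanSpace ℂ (Fin n),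
      DifferentiableOn ℂ f (ball 0 R) → Set.MapsTo f (ball 0 R) (ball z r) →
      (∀ ζ ∈ ball (0 : ℂ) R, g (f ζ) < 0) →
      ∀ ζ : ℂ, ‖ζ‖ < R / 2 → |g (f ζ) - g (f 0)| ≤ C * |g (f 0)| * (‖ζ‖ / R) := by
  have hstrict : HasStrictFDerivAt (fderiv ℝ g) (fderiv ℝ (fderiv ℝ g) z) z :=
    (hg.fderiv_right (m := 1) (by norm_num)).hasStrictFDerivAt (by norm_num)
  have hdiff : ∀ᶠ x in 𝓝 z, DifferentiableAt ℝ g x :=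
    (hg.eventually (by simp)).mono fun x hx => hx.differentiableAt (by norm_num)
  have hsymm : ∀ u v, fderiv ℝ (fderiv ℝ g) z u v = fderiv ℝ (fderiv ℝ g) z v u :=
    hg.isSymmSndFDerivAt (by simp)
  obtain ⟨Q, hQ⟩ := exists_complex_bilinear_re_eq (fderiv ℝ (fderiv ℝ g) z)
  have hlevi' : ∀ v, leviForm g z v = (fderiv ℝ (fderiv ℝ g) z v v
    + fderiv ℝ (fderiv ℝ g) z (Complex.I • v) (Complex.I • v)) / 4 := fun v => rfl
  generalize fderiv ℝ (fderiv ℝ g) z = B at *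
  -- An error of `c / 2` costs only half of the Levi form's positivity.
  obtain ⟨r, hr, htaylor⟩ := exists_ball_taylor_second_order hdiff hstrict hsymm
    (half_pos hc)
  refine ⟨r, hr, 4 + (‖B‖ / 2 + c / 2) * (6 / (c / 2)), by positivity, ?_⟩
  intro R hR f hf hmaps hneg ζ hζ
  have h0mem : (0 : ℂ) ∈ ball (0 : ℂ) R := mem_ball_self hR
  have hd : 0 < -g (f 0) := neg_pos.2 (hneg 0 h0mem)
  let V : ℂ → EuclideanSpace ℂ (Fin n) := fun ξ => f ξ - f 0
  have hV : DifferentiableOn ℂ V (ball 0 R) := hf.sub_const _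
  let ℓ : StrongDual ℂ (EuclideanSpace ℂ (Fin n)) :=
    StrongDual.extendRCLike (𝕜 := ℂ) (fderiv ℝ g (f 0))
  have hℓ : ∀ v, (ℓ v).re = fderiv ℝ g (f 0) v := fun v =>
    StrongDual.re_extendRCLike_apply (𝕜 := ℂ) (fderiv ℝ g (f 0)) v
  -- The pluriharmonic part of the Taylor polynomial: `ℓ` has real part `dg(f 0)`, and `Q` carries
  -- the `(2, 0)` part of `B`.
  let h : ℂ → ℂ := fun ξ => ℓ (V ξ) + Q (V ξ) (V ξ)
  have hh : DifferentiableOn ℂ h (ball 0 R) := by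
    refine (ℓ.differentiable.comp_differentiableOn hV).add ?_
    exact (Q.differentiable.comp_differentiableOn hV).clm_apply hV
  have hV0 : V 0 = 0 := sub_self _
  have hh0 : h 0 = 0 := by simp [h, hV0]
  have hT : ∀ ξ ∈ ball (0 : ℂ) R,
      |g (f ξ) - g (f 0) - (h ξ).re - leviForm g z (V ξ)| ≤ c / 2 * ‖V ξ‖ ^ 2 := by
    intro ξ hξ
    have h1 := htaylor (f 0) (hmaps h0mem) (f ξ) (hmaps hξ)
    have h2 : (h ξ).re + leviForm g z (V ξ)
        = fderiv ℝ g (f 0) (f ξ - f 0) + B (f ξ - f 0) (f ξ - f 0) / 2 := by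
      simp only [h, Complex.add_re, hℓ, hQ, hlevi', V]
      ring
    rw [show g (f ξ) - g (f 0) - (h ξ).re - leviForm g z (V ξ)
      = g (f ξ) - g (f 0) - ((h ξ).re + leviForm g z (V ξ)) by ring, h2]
    rwa [← sub_sub]
  obtain ⟨hb1, hb2⟩ := norm_le_of_re_add_mul_norm_sq_le (half_pos hc) hd hR hh hV hh0 hV0
    (fun ξ hξ => by
      have h1 := (abs_le.1 (hT ξ hξ)).1
      have h2 := hlevi (V ξ)
      have h3 := hneg ξ hξ
      linarith) hζ
  have hζR : ζ ∈ ball (0 : ℂ) R := by simp; linarith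
  have hBV : |leviForm g z (V ζ)| ≤ ‖B‖ / 2 * ‖V ζ‖ ^ 2 := by
    have h1 : |B (V ζ) (V ζ)| ≤ ‖B‖ * ‖V ζ‖ * ‖V ζ‖ := B.le_opNorm₂ _ _
    have h2 : |B (Complex.I • V ζ) (Complex.I • V ζ)|
      ≤ ‖B‖ * ‖Complex.I • V ζ‖ * ‖Complex.I • V ζ‖ := B.le_opNorm₂ _ _
    rw [norm_smul, Complex.norm_I, one_mul] at h2
    rw [hlevi', abs_le]
    constructor <;> nlinarith [abs_le.1 h1, abs_le.1 h2]
  have h1 := hT ζ hζR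
  have h2 := (Complex.abs_re_le_norm (h ζ)).trans hb1
  have h3 : (‖B‖ / 2 + c / 2) * ‖V ζ‖ ^ 2
      ≤ (‖B‖ / 2 + c / 2) * (6 * (-g (f 0) / (c / 2)) * (‖ζ‖ / R)) := by gcongr
  have h4 : (4 + (‖B‖ / 2 + c / 2) * (6 / (c / 2))) * |g (f 0)| * (‖ζ‖ / R)
      = 4 * -g (f 0) * (‖ζ‖ / R)
        + (‖B‖ / 2 + c / 2) * (6 * (-g (f 0) / (c / 2)) * (‖ζ‖ / R)) := by
    rw [abs_of_neg (neg_pos.1 hd)]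
    ring
  rw [h4]
  rw [abs_le] at *
  constructor <;> linarith [h1.1, h1.2, h2.1, h2.2, hBV.1, hBV.2]

/-! ### Strictly plurisubharmonic defining functions -/

/-- Adding a multiple of its square to a function vanishing at `z` adds a multiple of the square of
its derivative to the Levi form at `z`. -/
theorem leviForm_add_mul_sq {n : ℕ} {ρ : EuclideanSpace ℂ (Fin n) → ℝ}
    {z : EuclideanSpace ℂ (Fin n)} (hρ : ContDiffAt ℝ 2 ρ z) (h0 : ρ z = 0) (M : ℝ)
    (v : EuclideanSpace ℂ (Fin n)) :
    leviForm (fun w => ρ w + M * ρ w ^ 2) z v = leviForm ρ z v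
      + M / 2 * (fderiv ℝ ρ z v ^ 2 + fderiv ℝ ρ z (Complex.I • v) ^ 2) := by
  have hdiff : ∀ᶠ x in 𝓝 z, DifferentiableAt ℝ ρ x :=
    (hρ.eventually (by simp)).mono fun x hx => hx.differentiableAt (by norm_num)
  have h1 : fderiv ℝ (fun w => ρ w + M * ρ w ^ 2) =ᶠ[𝓝 z]
      fun w => (1 + 2 * M * ρ w) • fderiv ℝ ρ w := by
    filter_upwards [hdiff] with w hw
    have := hw.hasFDerivAt.add ((hw.hasFDerivAt.pow 2).const_mul M)
    refine this.fderiv.trans ?_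
    ext v
    simp
    ring
  have h2 : HasFDerivAt (fun w => (1 + 2 * M * ρ w) • fderiv ℝ ρ w)
      ((1 + 2 * M * ρ z) • fderiv ℝ (fderiv ℝ ρ) z
        + ((2 * M) • fderiv ℝ ρ z).smulRight (fderiv ℝ ρ z)) z :=
    HasFDerivAt.smul (((hρ.differentiableAt (by norm_num)).hasFDerivAt.const_mul (2 * M)).const_add
      1) ((hρ.fderiv_right (m := 1) (by norm_num)).differentiableAt (by norm_num)).hasFDerivAt
  unfold leviForm
  rw [h1.fderiv_eq, h2.fderiv]
  simp [h0]
  ring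

/-- Near a boundary point, a strongly pseudoconvex domain has a defining function with positive
definite Levi form. -/
theorem IsStronglyPseudoconvexDomain.exists_strictly_plurisubharmonic {n : ℕ}
    {Ω : Set (EuclideanSpace ℂ (Fin n))} (hΩ : IsStronglyPseudoconvexDomain Ω)
    {z : EuclideanSpace ℂ (Fin n)} (hz : z ∈ frontier Ω) :
    ∃ g : EuclideanSpace ℂ (Fin n) → ℝ, ∃ c > 0, ContDiffAt ℝ 2 g z ∧ fderiv ℝ g z ≠ 0 ∧
      (∀ v, c * ‖v‖ ^ 2 ≤ leviForm g z v) ∧ ∀ᶠ w in 𝓝 z, (w ∈ Ω ↔ g w < 0) := by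
  obtain ⟨U, ρ, hU, hzU, hρU, hΩU, hne, hlevi⟩ := hΩ.exists_definingFunction z hz
  have hUz : U ∈ 𝓝 z := hU.mem_nhds hzU
  have hρ : ContDiffAt ℝ 2 ρ z := hρU.contDiffAt hUz
  have hmem : ∀ w ∈ U, (w ∈ Ω ↔ ρ w < 0) := fun w hw =>
    ⟨fun h => ((Set.ext_iff.1 hΩU w).1 ⟨h, hw⟩).2, fun h => ((Set.ext_iff.1 hΩU w).2 ⟨hw, h⟩).1⟩
  have hρ0 : ρ z = 0 := by
    refine le_antisymm ?_ ?_
    · have hcl : z ∈ closure Ω := frontier_subset_closure hz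
      rw [mem_closure_iff_nhdsWithin_neBot] at hcl
      refine le_of_tendsto (hρ.continuousAt.tendsto.mono_left (nhdsWithin_le_nhds (s := Ω))) ?_
      filter_upwards [self_mem_nhdsWithin, mem_nhdsWithin_of_mem_nhds hUz] with w hw hwU
      exact ((hmem w hwU).1 hw).le
    · by_contra! hlt
      rw [hΩ.isOpen.frontier_eq] at hz
      exact hz.2 ((hmem z hzU).2 hlt)
  obtain ⟨M, hM, c, hc, hcM⟩ := exists_add_mul_ge_norm_sq (F := leviForm ρ z)
    (G := fun v => fderiv ℝ ρ z v ^ 2 + fderiv ℝ ρ z (Complex.I • v) ^ 2)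
    (by unfold leviForm; fun_prop) (by fun_prop)
    (fun t v => by
      unfold leviForm
      rw [smul_comm Complex.I t v]
      simp
      ring)
    (fun t v => by
      simp only [smul_comm Complex.I t v, map_smul, smul_eq_mul]
      ring)
    (fun v => by positivity)
    (fun v hv h0 => by
      have h1 := sq_nonneg (fderiv ℝ ρ z v)
      have h2 := sq_nonneg (fderiv ℝ ρ z (Complex.I • v))
      exact hlevi v hv (pow_eq_zero_iff two_ne_zero |>.1 (by linarith))
        (pow_eq_zero_iff two_ne_zero |>.1 (by linarith)))
  -- The factor `2 * M` offsets the `M / 2` in `leviForm_add_mul_sq`. The sign is unchanged near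
  -- `z`, since the function is `(1 + 2Mρ)ρ`.
  refine ⟨fun w => ρ w + (2 * M) * ρ w ^ 2, c, hc, by fun_prop, ?_, fun v => ?_, ?_⟩
  · have hd := (hρ.differentiableAt (by norm_num)).hasFDerivAt
    have : fderiv ℝ (fun w => ρ w + (2 * M) * ρ w ^ 2) z = fderiv ℝ ρ z := by
      refine (hd.add ((hd.pow 2).const_mul (2 * M))).fderiv.trans ?_
      ext v
      simp [hρ0]
    rwa [this]
  · rw [leviForm_add_mul_sq hρ hρ0]
    convert hcM v using 3
    ring
  · have : Tendsto (fun w => 1 + 2 * M * ρ w) (𝓝 z) (𝓝 (1 + 2 * M * 0)) := by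
      rw [← hρ0]
      exact (hρ.continuousAt.tendsto.const_mul _).const_add _
    filter_upwards [hUz, this.eventually (lt_mem_nhds (show (0 : ℝ) < 1 + 2 * M * 0 by simp))]
      with w hw hpos
    rw [hmem w hw, show ρ w + 2 * M * ρ w ^ 2 = (1 + 2 * M * ρ w) * ρ w by ring,
      mul_neg_iff]
    constructor
    · exact fun h => Or.inl ⟨hpos, h⟩
    · rintro (h | h)
      · exact h.2
      · exact absurd h.1 hpos.not_gt

/-! ### Chains of discs -/

/-- A holomorphic disc through two points can be recentred at the first one, with the second one at
a parameter of modulus at most the Poincaré distance. -/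
theorem exists_recentred_disc {E : Type*} [NormedAddCommGroup E] [NormedSpace ℂ E] {Ω : Set E}
    {f : ℂ → E} (hf : DifferentiableOn ℂ f (ball 0 1)) (hmaps : Set.MapsTo f (ball 0 1) Ω)
    {a b : ℂ} (ha : a ∈ ball (0 : ℂ) 1) (hb : b ∈ ball (0 : ℂ) 1) :
    ∃ F : ℂ → E, ∃ ζ : ℂ, DifferentiableOn ℂ F (ball 0 1) ∧ Set.MapsTo F (ball 0 1) Ω ∧
      F 0 = f a ∧ F ζ = f b ∧ ‖ζ‖ ≤ poincareDist a b := by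
  have hne : ∀ u ∈ ball (0 : ℂ) 1, ∀ v ∈ ball (0 : ℂ) 1, 1 - (starRingEnd ℂ) u * v ≠ 0 := by
    intro u hu v hv h
    rw [mem_ball_zero_iff] at hu hv
    have : ‖(starRingEnd ℂ) u * v‖ = 1 := by rw [← sub_eq_zero.1 h, norm_one]
    rw [norm_mul, RCLike.norm_conj] at this
    nlinarith [norm_nonneg u, norm_nonneg v]
  have hlt : ∀ u ∈ ball (0 : ℂ) 1, ∀ v ∈ ball (0 : ℂ) 1,
      ‖(u - v) / (1 - (starRingEnd ℂ) u * v)‖ < 1 := by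
    intro u hu v hv
    rw [norm_div, div_lt_one (norm_pos_iff.2 (hne u hu v hv)),
      ← sq_lt_sq₀ (norm_nonneg _) (norm_nonneg _)]
    rw [mem_ball_zero_iff, ← sq_lt_one_iff₀ (norm_nonneg _)] at hu hv
    rw [Complex.sq_norm, Complex.normSq_apply] at *
    rw [Complex.sq_norm, Complex.normSq_apply]
    simp only [Complex.sub_re, Complex.sub_im, Complex.one_re, Complex.one_im, Complex.mul_re,
      Complex.mul_im, Complex.conj_re, Complex.conj_im]
    nlinarith [mul_pos (sub_pos.2 hu) (sub_pos.2 hv)]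
  -- The involutive disc automorphism exchanging `0` and `a`.
  let φ : ℂ → ℂ := fun ξ => (a - ξ) / (1 - (starRingEnd ℂ) a * ξ)
  have hφ : Set.MapsTo φ (ball 0 1) (ball 0 1) := fun ξ hξ => by
    rw [mem_ball_zero_iff]
    exact hlt a ha ξ hξ
  have hφd : DifferentiableOn ℂ φ (ball 0 1) :=
    DifferentiableOn.div (by fun_prop) (by fun_prop) fun ξ hξ => hne a ha ξ hξ
  have hφφ : φ (φ b) = b := by
    have h1 := hne a ha b hb
    have h2 := hne a ha (φ b) (hφ hb)
    change (a - φ b) / (1 - (starRingEnd ℂ) a * φ b) = b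
    rw [div_eq_iff h2]
    have h3 : φ b * (1 - (starRingEnd ℂ) a * b) = a - b := div_mul_cancel₀ _ h1
    refine mul_right_cancel₀ h1 ?_
    linear_combination (-(1 - (starRingEnd ℂ) a * b)) * h3
  refine ⟨f ∘ φ, φ b, hf.comp hφd hφ, hmaps.comp hφ, by simp [φ], by simp [hφφ], ?_⟩
  have ht : ‖(a - b) / (1 - (starRingEnd ℂ) b * a)‖ = ‖φ b‖ := by
    simp only [φ, norm_div]
    congr 1
    rw [← RCLike.norm_conj]
    simp [mul_comm]
  have h1 : ‖φ b‖ < 1 := hlt a ha b hb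
  have h0 := norm_nonneg (φ b)
  unfold poincareDist
  rw [ht, Real.log_div (by linarith) (by linarith)]
  have h2 := Real.log_nonneg (show (1 : ℝ) ≤ 1 + ‖φ b‖ by linarith)
  have h3 := Real.log_le_sub_one_of_pos (show (0 : ℝ) < 1 - ‖φ b‖ by linarith)
  linarith

/-- Apply `log x ≤ x - 1` to `s / t` and to `t / s`; `u ≤ 1 / 2` gives `s / t ≥ 1 / 2`, whence the
factor 2. -/
theorem abs_log_neg_sub_log_neg_le {s t u : ℝ} (ht : t < 0) (hu : u ≤ 1 / 2)
    (h : |s - t| ≤ u * |t|) : |Real.log (-s) - Real.log (-t)| ≤ 2 * u := by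
  rw [abs_of_neg ht, abs_le] at h
  have hs : 0 < -s := by nlinarith
  have ht' : 0 < -t := by linarith
  have hu0 : 0 ≤ u := by nlinarith
  have h1 := Real.log_le_sub_one_of_pos (div_pos hs ht')
  have h2 := Real.log_le_sub_one_of_pos (div_pos ht' hs)
  rw [Real.log_div (by linarith) (by linarith)] at h1 h2
  have h3 : -s / -t - 1 ≤ 2 * u := by
    rw [sub_le_iff_le_add, div_le_iff₀ ht']
    nlinarith
  have h4 : -t / -s - 1 ≤ 2 * u := by
    rw [sub_le_iff_le_add, div_le_iff₀ hs]
    nlinarith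
  rw [abs_le]
  constructor <;> linarith

/-- Near a strongly pseudoconvex boundary point, the logarithm of a suitable defining function is
Lipschitz along short chains of holomorphic discs. -/
theorem exists_abs_log_sub_le_of_isDiscChainLength {n : ℕ} {Ω : Set (EuclideanSpace ℂ (Fin n))}
    (hΩ : Bornology.IsBounded Ω) {g : EuclideanSpace ℂ (Fin n) → ℝ}
    {z : EuclideanSpace ℂ (Fin n)} (hg : ContDiffAt ℝ 2 g z) {c : ℝ} (hc : 0 < c)
    (hlevi : ∀ v, c * ‖v‖ ^ 2 ≤ leviForm g z v) (hdef : ∀ᶠ w in 𝓝 z, w ∈ Ω → g w < 0) :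
    ∃ η > 0, ∃ K > 0, ∀ x ∈ Ω ∩ ball z η, ∀ y, ∀ L < η, IsDiscChainLength Ω x y L →
      |Real.log (-g y) - Real.log (-g x)| ≤ K * L := by
  obtain ⟨r₁, hr₁, C, hC, hdisc⟩ := exists_ball_abs_sub_le_along_disc hg hc hlevi
  obtain ⟨r₂, hr₂, hneg⟩ := Metric.eventually_nhds_iff_ball.1 hdef
  obtain ⟨D, hD, hdiam⟩ : ∃ D > 0, ∀ p ∈ Ω, ∀ q ∈ Ω, dist p q ≤ D := by
    obtain ⟨D, hD⟩ := Metric.isBounded_iff.1 hΩ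
    exact ⟨max D 1, by positivity, fun p hp q hq => (hD hp hq).trans (le_max_left _ _)⟩
  set r := min r₁ r₂
  have hr0 : 0 < r := lt_min hr₁ hr₂
  -- By Schwarz, a disc in `Ω` moves at most `D * R ≤ r / 2` on the radius `R`, so it stays in `ball
  -- z r` if centred in `ball z (r / 2)`.
  set R := min 1 (r / (2 * D))
  have hR0 : 0 < R := lt_min one_pos (by positivity)
  have hR1 : R ≤ 1 := min_le_left _ _
  have hDR : D * R ≤ r / 2 := by
    calc D * R ≤ D * (r / (2 * D)) := by gcongr; exact min_le_right _ _
      _ = r / 2 := by field_simp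
  have step : ∀ F : ℂ → EuclideanSpace ℂ (Fin n), ∀ ζ : ℂ, DifferentiableOn ℂ F (ball 0 1) →
      Set.MapsTo F (ball 0 1) Ω → F 0 ∈ ball z (r / 2) → ‖ζ‖ < R / 2 →
      dist (F ζ) (F 0) ≤ D * ‖ζ‖ ∧ |g (F ζ) - g (F 0)| ≤ C / R * ‖ζ‖ * |g (F 0)| := by
    intro F ζ hF hFΩ hF0 hζ
    have hschwarz : ∀ ξ ∈ ball (0 : ℂ) 1, dist (F ξ) (F 0) ≤ D * ‖ξ‖ := by
      intro ξ hξ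
      simpa using Complex.dist_le_div_mul_dist_of_mapsTo_ball hF (R₂ := D)
        (fun ξ hξ => hdiam _ (hFΩ hξ) _ (hFΩ (mem_ball_self one_pos))) hξ
    have hsub : ball (0 : ℂ) R ⊆ ball 0 1 := ball_subset_ball hR1
    have hin : ∀ ξ ∈ ball (0 : ℂ) R, F ξ ∈ ball z r := by
      intro ξ hξ
      have h1 := hschwarz ξ (hsub hξ)
      have h2 : D * ‖ξ‖ ≤ D * R := by
        gcongr
        exact (mem_ball_zero_iff.1 hξ).le
      have h3 := dist_triangle (F ξ) (F 0) z
      rw [mem_ball] at hF0 ⊢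
      linarith
    refine ⟨hschwarz ζ (hsub (by simp; linarith)), ?_⟩
    have := hdisc R hR0 F (hF.mono hsub)
      (fun ξ hξ => ball_subset_ball (min_le_left _ _) (hin ξ hξ))
      (fun ξ hξ => hneg _ (ball_subset_ball (min_le_right _ _) (hin ξ hξ)) (hFΩ (hsub hξ))) ζ hζ
    exact this.trans_eq (by ring)
  -- The bounds on `L` in turn: `D * L < r / 4` keeps the chain in `ball z (r / 2)`, `L < R / 2`
  -- permits the disc estimate, and `C / R * L < 1 / 2` permits passing to logarithms.
  refine ⟨min (r / 4) (min (r / (4 * D)) (min (R / 2) (R / (2 * C)))), by positivity,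
    2 * (C / R), by positivity, ?_⟩
  rintro x ⟨hxΩ, hx⟩ y L hL ⟨m, p, f, a, b, hp0, hpm, hchain, rfl⟩
  simp only [lt_min_iff] at hL
  obtain ⟨-, hL1, hL2, hL3⟩ := hL
  have hx4 : dist x z < r / 4 := (mem_ball.1 hx).trans_le (min_le_left _ _)
  rw [lt_div_iff₀ (by positivity)] at hL1 hL3
  have hrec : ∀ i < m, ∃ F : ℂ → EuclideanSpace ℂ (Fin n), ∃ ζ : ℂ,
      DifferentiableOn ℂ F (ball 0 1) ∧ Set.MapsTo F (ball 0 1) Ω ∧ F 0 = p i ∧ F ζ = p (i + 1) ∧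
      ‖ζ‖ ≤ poincareDist (a i) (b i) := by
    intro i hi
    obtain ⟨h1, h2, h3, h4, h5, h6⟩ := hchain i hi
    rw [← h5, ← h6]
    exact exists_recentred_disc h1 h2 h3 h4
  have hpos : ∀ i < m, 0 ≤ poincareDist (a i) (b i) := by
    intro i hi
    obtain ⟨F, ζ, -, -, -, -, h⟩ := hrec i hi
    exact (norm_nonneg ζ).trans h
  have hpart : ∀ j ≤ m, ∑ i ∈ Finset.range j, poincareDist (a i) (b i)
      ≤ ∑ i ∈ Finset.range m, poincareDist (a i) (b i) := fun j hj =>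
    Finset.sum_le_sum_of_subset_of_nonneg (Finset.range_subset_range.2 hj)
      fun i hi _ => hpos i (Finset.mem_range.1 hi)
  have key : ∀ j ≤ m, p j ∈ Ω ∧
      dist (p j) x ≤ D * ∑ i ∈ Finset.range j, poincareDist (a i) (b i) ∧
      |Real.log (-g (p j)) - Real.log (-g x)|
        ≤ 2 * (C / R) * ∑ i ∈ Finset.range j, poincareDist (a i) (b i) := by
    intro j
    induction j with
    | zero => simp [hp0, hxΩ]
    | succ j ih =>
      intro hj
      obtain ⟨hpΩ, hdist, hlog⟩ := ih (by omega)
      obtain ⟨F, ζ, hF, hFΩ, hF0, hF1, hζ⟩ := hrec j hj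
      have hsum := hpart (j + 1) hj
      have hsum' := hpart j (by omega)
      rw [Finset.sum_range_succ] at hsum
      have hsum0 : 0 ≤ ∑ i ∈ Finset.range j, poincareDist (a i) (b i) :=
        Finset.sum_nonneg fun i hi => hpos i ((Finset.mem_range.1 hi).trans hj)
      rw [Finset.sum_range_succ]
      have hpz : p j ∈ ball z (r / 2) := by
        have h1 := dist_triangle (p j) x z
        have h2 := mul_le_mul_of_nonneg_left hsum' hD.le
        rw [mem_ball]
        linarith
      have hζL : ‖ζ‖ ≤ ∑ i ∈ Finset.range m, poincareDist (a i) (b i) := by linarith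
      obtain ⟨hs1, hs2⟩ := step F ζ hF hFΩ (hF0 ▸ hpz) (by linarith)
      rw [hF0, hF1] at hs1 hs2
      have hpj : g (p j) < 0 := hneg _
        (ball_subset_ball ((half_le_self hr0.le).trans (min_le_right _ _)) hpz) hpΩ
      have hs3 := abs_log_neg_sub_log_neg_le hpj (by
        rw [div_mul_eq_mul_div, div_le_iff₀ hR0]
        have := mul_le_mul_of_nonneg_left hζL hC.le
        linarith) hs2
      have hs4 : C / R * ‖ζ‖ ≤ C / R * poincareDist (a j) (b j) := by gcongr
      refine ⟨?_, ?_, ?_⟩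
      · obtain ⟨-, h2, -, h4, -, h6⟩ := hchain j hj
        exact h6 ▸ h2 h4
      · have h1 := dist_triangle (p (j + 1)) (p j) x
        have h2 := mul_le_mul_of_nonneg_left hζ hD.le
        linarith
      · have h1 := abs_sub_le (Real.log (-g (p (j + 1)))) (Real.log (-g (p j)))
          (Real.log (-g x))
        linarith
  rw [← hpm]
  exact (key m le_rfl).2.2

/-! ### Defining functions and boundary distance -/

/-- A defining function is asymptotic to a multiple of the distance to the boundary. -/
theorem tendsto_neg_div_infDist_frontier {E : Type*} [NormedAddCommGroup E] [NormedSpace ℝ E]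
    [FiniteDimensional ℝ E] {Ω : Set E} {g : E → ℝ} {z : E} {A : E →L[ℝ] ℝ}
    (hg : HasStrictFDerivAt g A z) (hA : A ≠ 0) (hΩ : IsOpen Ω) (hz : z ∈ frontier Ω)
    (hdef : ∀ᶠ w in 𝓝 z, (w ∈ Ω ↔ g w < 0)) :
    Tendsto (fun w => -g w / infDist w (frontier Ω)) (𝓝[Ω] z) (𝓝 ‖A‖) := by
  have : ProperSpace E := FiniteDimensional.proper ℝ E
  have hA0 : 0 < ‖A‖ := norm_pos_iff.2 hA
  have hzΩ : z ∉ Ω := (hΩ.frontier_eq ▸ hz).2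
  have hgz : 0 ≤ g z := not_lt.1 fun h => hzΩ (hdef.self_of_nhds.2 h)
  have hpos : ∀ w ∈ Ω, 0 < infDist w (frontier Ω) := fun w hw =>
    (isClosed_frontier.notMem_iff_infDist_pos ⟨z, hz⟩).1
      fun h => (hΩ.frontier_eq ▸ h).2 hw
  suffices H : ∀ ε > 0, ε < ‖A‖ / 4 → ∀ᶠ w in 𝓝[Ω] z,
      (‖A‖ - 3 * ε) * infDist w (frontier Ω) ≤ -g w ∧
        -g w ≤ (‖A‖ + ε) * infDist w (frontier Ω) by
    rw [Metric.tendsto_nhds]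
    intro ε hε
    have h0 : 0 < min (ε / 6) (‖A‖ / 8) := by positivity
    filter_upwards [H _ h0 ((min_le_right _ _).trans_lt (by linarith)), self_mem_nhdsWithin]
      with w hw hwΩ
    have h1 := hpos w hwΩ
    have h2 : min (ε / 6) (‖A‖ / 8) ≤ ε / 6 := min_le_left _ _
    rw [Real.dist_eq, abs_lt, lt_sub_iff_add_lt, sub_lt_iff_lt_add, lt_div_iff₀ h1, div_lt_iff₀ h1]
    constructor <;> nlinarith [hw.1, hw.2]
  intro ε hε hεA
  obtain ⟨r₁, hr₁, h₁⟩ := Metric.eventually_nhds_iff_ball.1 (hg.isLittleO.def hε)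
  obtain ⟨r₂, hr₂, h₂⟩ := Metric.eventually_nhds_iff_ball.1 hdef
  obtain ⟨v, hv1, hv⟩ : ∃ v : E, ‖v‖ ≤ 1 ∧ ‖A‖ - ε < A v := by
    obtain ⟨v, hv, hAv⟩ := A.exists_lt_apply_of_lt_opNorm (show ‖A‖ - ε < ‖A‖ by linarith)
    rcases le_or_gt 0 (A v) with h | h
    · exact ⟨v, hv.le, by rwa [Real.norm_of_nonneg h] at hAv⟩
    · exact ⟨-v, by simpa using hv.le, by rw [map_neg]; rwa [Real.norm_of_nonpos h.le] at hAv⟩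
  set r := min r₁ r₂
  have hr0 : 0 < r := lt_min hr₁ hr₂
  have hlip : ∀ p ∈ ball z r, ∀ q ∈ ball z r, |g p - g q - A (p - q)| ≤ ε * ‖p - q‖ := by
    intro p hp q hq
    refine h₁ (p, q) ?_
    rw [← ball_prod_same]
    exact ⟨ball_subset_ball (min_le_left _ _) hp, ball_subset_ball (min_le_left _ _) hq⟩
  have hmem : ∀ w ∈ ball z r, (w ∈ Ω ↔ g w < 0) := fun w hw =>
    h₂ w (ball_subset_ball (min_le_right _ _) hw)
  have hcont : ∀ᶠ w in 𝓝 z, -g w < (‖A‖ - 2 * ε) * (r / 2) :=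
    hg.continuousAt.neg.eventually (gt_mem_nhds
      (show -g z < _ from (neg_nonpos.2 hgz).trans_lt (mul_pos (by linarith) (by positivity))))
  filter_upwards [self_mem_nhdsWithin, mem_nhdsWithin_of_mem_nhds hcont,
    mem_nhdsWithin_of_mem_nhds (ball_mem_nhds z (half_pos hr0))] with w hwΩ hwg hwz
  have hwr : w ∈ ball z r := ball_subset_ball (half_le_self hr0.le) hwz
  have hgw : g w < 0 := (hmem w hwr).1 hwΩ
  constructor
  -- Moving from `w` by `t • v` raises `g` by at least `t * (‖A‖ - 2 * ε) = -g w`: one `ε` is lost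
  -- in the choice of `v`, one in linearization. So the path leaves `Ω`, and the boundary is within
  -- `t`.
  · set t := -g w / (‖A‖ - 2 * ε) with ht
    have hden : 0 < ‖A‖ - 2 * ε := by linarith
    have ht0 : 0 < t := div_pos (by linarith) hden
    have htr : t < r / 2 := by rw [ht, div_lt_iff₀ hden]; linarith [hwg]
    have htv : ‖t • v‖ ≤ t := by
      rw [norm_smul, Real.norm_of_nonneg ht0.le]
      exact mul_le_of_le_one_right ht0.le hv1
    have hout : w + t • v ∉ Ω := by
      have hin : w + t • v ∈ ball z r := by
        rw [mem_ball, dist_eq_norm] at hwz ⊢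
        have := norm_add_le (w - z) (t • v)
        rw [show w + t • v - z = w - z + t • v by abel]
        linarith
      rw [hmem _ hin, not_lt]
      have h1 := (abs_le.1 (hlip _ hin w hwr)).1
      rw [add_sub_cancel_left, map_smul, smul_eq_mul] at h1
      have h2 : t * (‖A‖ - 2 * ε) = -g w := div_mul_cancel₀ _ hden.ne'
      nlinarith
    obtain ⟨y, hy, hyd⟩ := exists_mem_frontier_infDist_compl_eq_dist hwΩ
      (fun h => hzΩ (h ▸ Set.mem_univ z))
    have h3 : infDist w (frontier Ω) ≤ t := by
      calc infDist w (frontier Ω) ≤ dist w y := infDist_le_dist_of_mem hy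
        _ = infDist w Ωᶜ := hyd.symm
        _ ≤ dist w (w + t • v) := infDist_le_dist_of_mem hout
        _ ≤ t := by rwa [dist_self_add_right]
    rw [ht, le_div_iff₀ hden] at h3
    nlinarith [hpos w hwΩ]
  -- Compare with a nearest boundary point `q`, where `g q ≥ 0`.
  · obtain ⟨q, hq, hqd⟩ := isClosed_frontier.exists_infDist_eq_dist ⟨z, hz⟩ w
    have hwq : dist w q ≤ dist w z := hqd ▸ infDist_le_dist_of_mem hz
    have hqr : q ∈ ball z r := by
      have := dist_triangle_left q z w
      rw [mem_ball] at hwz ⊢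
      linarith
    have hgq : 0 ≤ g q := not_lt.1 fun h => (hΩ.frontier_eq ▸ hq).2 ((hmem q hqr).2 h)
    have h1 := (abs_le.1 (hlip w hwr q hqr)).1
    have h2 := (abs_le.1 (A.le_opNorm (w - q))).1
    rw [hqd, dist_eq_norm]
    linarith

/-! ### Conclusion -/

theorem exists_isDiscChainLength_lt {n : ℕ} {Ω : Set (EuclideanSpace ℂ (Fin n))}
    {x y : EuclideanSpace ℂ (Fin n)} {ε : ℝ}
    (h : kobayashiDist Ω x y < ENNReal.ofReal ε) : ∃ L < ε, IsDiscChainLength Ω x y L := by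
  simp only [kobayashiDist, iInf_lt_iff] at h
  obtain ⟨L, hL, h⟩ := h
  exact ⟨L, (ENNReal.ofReal_lt_ofReal_iff').1 h |>.1, hL⟩

theorem mainTheorem6 {n : ℕ} (Ω : Set (EuclideanSpace ℂ (Fin n)))
    (hΩ : IsStronglyPseudoconvexDomain Ω)
    (x y : ℕ → EuclideanSpace ℂ (Fin n)) (hx : ∀ k, x k ∈ Ω) (hy : ∀ k, y k ∈ Ω)
    (z : EuclideanSpace ℂ (Fin n)) (hz : z ∈ frontier Ω)
    (hxz : Tendsto x atTop (𝓝 z)) (hyz : Tendsto y atTop (𝓝 z))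
    (hd : Tendsto (fun k => kobayashiDist Ω (x k) (y k)) atTop (𝓝 0)) :
    Tendsto (fun k => infDist (x k) (frontier Ω) / infDist (y k) (frontier Ω)) atTop (𝓝 1) := by
  obtain ⟨g, c, hc, hg, hg0, hlevi, hdef⟩ := hΩ.exists_strictly_plurisubharmonic hz
  obtain ⟨η, hη, K, hK, hlip⟩ := exists_abs_log_sub_le_of_isDiscChainLength hΩ.isBounded hg hc
    hlevi (hdef.mono fun w hw => hw.1)
  have hlog : Tendsto (fun k => Real.log (-g (y k)) - Real.log (-g (x k))) atTop (𝓝 0) := by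
    rw [Metric.tendsto_nhds]
    intro ε hε
    have h0 : 0 < min η (ε / K) := by positivity
    filter_upwards [hd.eventually (gt_mem_nhds (ENNReal.ofReal_pos.2 h0)),
      hxz.eventually (ball_mem_nhds z hη)] with k hk hxk
    obtain ⟨L, hL, hchain⟩ := exists_isDiscChainLength_lt hk
    rw [lt_min_iff, lt_div_iff₀ hK] at hL
    have := hlip (x k) ⟨hx k, hxk⟩ (y k) L hL.1 hchain
    rw [dist_zero_right, Real.norm_eq_abs]
    linarith
  have hexp := (Real.continuous_exp.tendsto 0).comp hlog
  rw [Real.exp_zero] at hexp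
  have hA := tendsto_neg_div_infDist_frontier (hg.hasStrictFDerivAt (by norm_num)) hg0 hΩ.isOpen hz
    hdef
  have hxA := hA.comp (tendsto_nhdsWithin_iff.2 ⟨hxz, Eventually.of_forall hx⟩)
  have hyA := hA.comp (tendsto_nhdsWithin_iff.2 ⟨hyz, Eventually.of_forall hy⟩)
  have hA0 : ‖fderiv ℝ g z‖ ≠ 0 := norm_ne_zero_iff.2 hg0
  -- Dividing the quotient of `-g / δ` at `y k` and `x k` by `g (y k) / g (x k)` cancels `g` and
  -- leaves `δ (x k) / δ (y k)`.
  have hlim := (hyA.div hxA hA0).div hexp one_ne_zero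
  rw [div_self hA0, div_one] at hlim
  refine hlim.congr' ?_
  filter_upwards [hxz.eventually hdef, hyz.eventually hdef] with k hxk hyk
  have hgx : 0 < -g (x k) := neg_pos.2 (hxk.1 (hx k))
  have hgy : 0 < -g (y k) := neg_pos.2 (hyk.1 (hy k))
  simp only [Pi.div_apply, Function.comp_apply]
  rw [Real.exp_sub, Real.exp_log hgx, Real.exp_log hgy]
  generalize -g (x k) = a at *
  generalize -g (y k) = b at *
  field_simp
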